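/- For a group $G$ let $\hat G$ denote its profinite completion (the inverse limit of the finite quotients of $G$, as a topological group). A group $G$ is called \emph{good} (in the sense of Serre) if for every finite $G$-module $M$ and every integer $n\ge 0$ the canonical map $H^n(\hat G,M)\to H^n(G,M)$ induced by $G\to\hat G$ is an isomorphism, where $H^n(\hat G,M)$ is continuous cohomology, $M$ has the discrete topology, and $\hat G$ acts on $M$ by the unique continuous extension of the action of $G$. \textbf{Lemma.} Let $1\to A\to G\xrightarrow{\pi} Q\to 1$ be a short exact sequence of groups in which (the image of) $A$ is contained in the centre $Z(G)$. Suppose that $A$ is finitely generated and that $Q$ is finitely generated and good. If the induced sequence of profinite completions $1\to\hat A\to\hat G\xrightarrow{\hat\pi}\hat Q\to 1$ splits, i.e. there is a continuous homomorphism $s:\hat Q\to\hat G$ with $\hat\pi\circ s=\mathrm{id}_{\hat Q}$, then the original sequence splits, i.e. there is a homomorphism $\sigma: Q\to G$ with $\pi\circ\sigma=\mathrm{id}_Q$. -/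

import Mathlib

open CategoryTheory

universe u

noncomputable section

namespace Goodness

variable (G : Type u) [Group G]

/-- The profinite completion of `G`. -/
abbrev Completion : ProfiniteGrp.{u} :=
  ProfiniteGrp.profiniteCompletion.obj (GrpCat.of G)

/-- The canonical homomorphism from `G`, taken with the discrete topology, to its profinite
completion. -/
def toCompletion [TopologicalSpace G] [DiscreteTopology G] : G →ₜ* Completion G where
  toMonoidHom := (ProfiniteGrp.ProfiniteCompletion.eta (GrpCat.of G)).hom
  continuous_toFun := continuous_of_discreteTopology

variable {G} in
/-- The continuous homomorphism of profinite completions induced by a homomorphism of groups. -/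
def completionMap {H : Type u} [Group H] (f : G →* H) : Completion G →ₜ* Completion H :=
  (ProfiniteGrp.profiniteCompletion.map (GrpCat.ofHom f)).hom

section Modules

variable (M : Type u) [AddCommGroup M]

/-- The homomorphism `Ĝ → Aut M` extending the action of `G` on a finite `G`-module `M`,
given by the universal property of `Ĝ` (`Aut M` is finite and carries the discrete topology). -/
def extendedAction [Finite M] [DistribMulAction G M] : Completion G →* M ≃ₗ[ℤ] M :=
  have : Finite (M ≃ₗ[ℤ] M) := Finite.of_injective _ DFunLike.coe_injective
  (ProfiniteGrp.ProfiniteCompletion.lift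
    (P := ProfiniteGrp.ofFiniteGrp (FiniteGrp.of (M ≃ₗ[ℤ] M)))
    (GrpCat.ofHom (DistribMulAction.toModuleAut (S := G) ℤ M))).hom.toMonoidHom

/-- The extended action restricts to the given action along `G → Ĝ`. -/
theorem extendedAction_toCompletion [Finite M] [DistribMulAction G M]
    [TopologicalSpace G] [DiscreteTopology G] (g : G) :
    extendedAction G M (toCompletion G g) = DistribMulAction.toModuleAut (S := G) ℤ M g := by
  have : Finite (M ≃ₗ[ℤ] M) := Finite.of_injective _ DFunLike.coe_injective
  exact ConcreteCategory.congr_hom (ProfiniteGrp.ProfiniteCompletion.lift_eta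
    (P := ProfiniteGrp.ofFiniteGrp (FiniteGrp.of (M ≃ₗ[ℤ] M)))
    (GrpCat.ofHom (DistribMulAction.toModuleAut (S := G) ℤ M))) g

variable {G M}
variable [TopologicalSpace M] [DiscreteTopology M]

/-- An action of a group on a discrete abelian group by automorphisms, as a topological
representation over `ℤ`. -/
def discreteRep {K : Type u} [Group K] (ρ : K →* M ≃ₗ[ℤ] M) : TopRep.{u} ℤ K :=
  TopRep.of (ContRepresentation.ofMonoidHom (V := M) (R := ℤ)
    { toFun := fun k =>
        { toLinearMap := (ρ k : M →ₗ[ℤ] M)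
          cont := continuous_of_discreteTopology }
      map_one' := by ext; simp
      map_mul' := fun _ _ => by ext; simp })

variable (G M)
variable [Finite M] [DistribMulAction G M] [TopologicalSpace G] [DiscreteTopology G]

/-- The identity of `M`, as a map from the `Ĝ`-module `M` restricted to `G`, to the
`G`-module `M`. -/
def restrictionHom :
    TopRep.res (toCompletion G : G →* Completion G) (discreteRep (extendedAction G M)) ⟶
      discreteRep (DistribMulAction.toModuleAut (S := G) ℤ M) :=
  TopRep.ofHom
    { toContinuousLinearMap := ContinuousLinearMap.id ℤ M
      isIntertwining' := fun g => by
        ext m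
        exact DFunLike.congr_fun (extendedAction_toCompletion G M g) m }

/-- The canonical map `Hⁿ(Ĝ, M) → Hⁿ(G, M)` induced by `G → Ĝ`, from the continuous cohomology of
the profinite completion to the cohomology of the discrete group `G`. -/
def comparisonMap (n : ℕ) :
    continuousCohomology.{0, u, u} n (discreteRep (extendedAction G M)) ⟶
      continuousCohomology.{0, u, u} n (discreteRep (DistribMulAction.toModuleAut (S := G) ℤ M)) :=
  ContinuousCohomology.map (toCompletion G) (restrictionHom G M) n

end Modules

/-- A group `G` is good (in the sense of Serre) if `Hⁿ(Ĝ, M) → Hⁿ(G, M)` is an isomorphism of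
abelian groups for every finite `G`-module `M` and every `n ≥ 0`. Here `G` and `M` carry the
discrete topology. -/
def IsGood : Prop :=
  ∀ [TopologicalSpace G] [DiscreteTopology G] (M : Type u) [AddCommGroup M] [Finite M]
    [TopologicalSpace M] [DiscreteTopology M] [DistribMulAction G M] (n : ℕ),
    Function.Bijective (comparisonMap G M n)

variable {G}

/-- The sequence of profinite completions `Â → Ĝ → Q̂` induced by an extension splits: `Ĝ → Q̂` has
a section that is a continuous homomorphism. -/
def CompletionSplits {A Q : Type u} [Group A] [Group Q] (S : GroupExtension A G Q) : Prop :=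
  ∃ s : Completion Q →ₜ* Completion G, ∀ x, completionMap S.rightHom (s x) = x

end Goodness

end

/-!
Write `π : G → Q` for the projection of the central extension.

Fix a homomorphism from `A` to a finite abelian group `M`. The extension pushed out to `M` is given
by a 2-cocycle on `Q` with trivial coefficients, and goodness makes it cohomologous to the
restriction of a continuous cocycle `f` on `Q̂` (`Goodness.IsGood.exists_continuous_twoCocycle`).
The extension of `Q̂` by `M` with cocycle `f` is a profinite group receiving a map from `G`, hence
from `Ĝ`, so the section `Q̂ → Ĝ` trivializes the pull-back of `f` to `Q`. Therefore `A → M` extends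
to `G` (`Goodness.exists_hom_of_completionSplits`). Exactness of the sequence of profinite
completions is not needed for this.

Apply this to all `A → A / nA` with `n > 0`. The extensions factor through the abelianization of
`G`. They show that an element of `A` that is divisible by `n` there is divisible by `n` in `A`; as
a finitely generated abelian group has no nonzero infinitely divisible elements, `A` embeds into the
abelianization, as a pure subgroup. The abelianization is finitely generated, so its pure subgroup
`A` is a direct summand (`AddMonoidHom.exists_retraction_of_pure`). The resulting retraction of `G`
onto `A` splits the extension because `A` is central
(`GroupExtension.nonempty_splitting_of_retraction`).
-/

/-! ### Cycles and homology of complexes of topological modules -/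

namespace TopModuleCat

open Limits

universe v w

variable {R : Type v} [Ring R] [TopologicalSpace R] {ι : Type*} {c : ComplexShape ι}
  (K : HomologicalComplex (TopModuleCat.{w} R) c)

theorem exists_iCycles_eq {i j : ι} (hj : c.next i = j) (x : K.X i) (hx : K.d i j x = 0) :
    ∃ z : K.cycles i, K.iCycles i z = x := by
  let e := (K.cyclesIsKernel i j hj).conePointUniqueUpToIso (isLimitKer (K.d i j))
  have he : e.inv ≫ K.iCycles i = kerι (K.d i j) :=
    (K.cyclesIsKernel i j hj).conePointUniqueUpToIso_inv_comp _ WalkingParallelPair.zero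
  exact ⟨e.inv ⟨x, hx⟩, ConcreteCategory.congr_hom he ⟨x, hx⟩⟩

theorem homologyπ_surjective (i : ι) : Function.Surjective (K.homologyπ i) := by
  let e := (K.homologyIsCokernel _ i rfl).coconePointUniqueUpToIso
    (isColimitCoker (K.toCycles (c.prev i) i))
  have he : cokerπ (K.toCycles (c.prev i) i) ≫ e.inv = K.homologyπ i :=
    (K.homologyIsCokernel _ i rfl).comp_coconePointUniqueUpToIso_inv
      (isColimitCoker (K.toCycles (c.prev i) i)) WalkingParallelPair.one
  intro h
  -- The homology object is isomorphic to the concrete quotient, compatibly with the projections.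
  obtain ⟨z, hz⟩ := cokerπ_surjective (K.toCycles (c.prev i) i) (e.hom h)
  refine ⟨z, ?_⟩
  rw [← he]
  change e.inv (cokerπ _ z) = h
  erw [hz]
  exact ConcreteCategory.congr_hom e.hom_inv_id h

theorem exists_d_eq_of_homologyπ_eq_zero {i j : ι} (hi : c.prev j = i) (z : K.cycles j)
    (hz : K.homologyπ j z = 0) : ∃ y : K.X i, K.d i j y = K.iCycles j z := by
  let e := (K.homologyIsCokernel i j hi).coconePointUniqueUpToIso
    (isColimitCoker (K.toCycles i j))
  have he : K.homologyπ j ≫ e.hom = cokerπ (K.toCycles i j) :=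
    (K.homologyIsCokernel i j hi).comp_coconePointUniqueUpToIso_hom
      (isColimitCoker (K.toCycles i j)) WalkingParallelPair.one
  have h0 : cokerπ (K.toCycles i j) z = 0 := by
    rw [← he]
    change e.hom (K.homologyπ j z) = 0
    rw [hz, map_zero]
  obtain ⟨y, hy⟩ := (Submodule.Quotient.mk_eq_zero _).1 h0
  refine ⟨y, ?_⟩
  rw [← hy]
  exact (ConcreteCategory.congr_hom (K.toCycles_i i j) y).symm

/-- Surjectivity of a map on homology, read off on chains: every cycle of the target is, up to a
boundary, the image of a cycle of the source. `TopModuleCat` is not abelian, so the diagram-chasing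
lemmas for abelian categories do not apply. -/
theorem exists_cycle_of_homologyMap_surjective
    {K L : HomologicalComplex (TopModuleCat.{w} R) c} (φ : K ⟶ L) {i j k : ι} (hi : c.prev j = i)
    (hk : c.next j = k) (hφ : Function.Surjective (HomologicalComplex.homologyMap φ j))
    (y : L.X j) (hy : L.d j k y = 0) :
    ∃ x : K.X j, K.d j k x = 0 ∧ ∃ w : L.X i, φ.f j x = y + L.d i j w := by
  obtain ⟨z, rfl⟩ := exists_iCycles_eq L hk y hy
  obtain ⟨h, hh⟩ := hφ (L.homologyπ j z)
  obtain ⟨x, rfl⟩ := homologyπ_surjective K j h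
  have hnat : L.homologyπ j (HomologicalComplex.cyclesMap φ j x) = L.homologyπ j z :=
    (ConcreteCategory.congr_hom (HomologicalComplex.homologyπ_naturality φ j) x).symm.trans hh
  obtain ⟨w, hw⟩ := exists_d_eq_of_homologyπ_eq_zero L hi
    (HomologicalComplex.cyclesMap φ j x - z) (by rw [map_sub, hnat, sub_self])
  refine ⟨K.iCycles j x, ConcreteCategory.congr_hom (K.iCycles_d j k) x, w, ?_⟩
  rw [hw, map_sub, add_sub_cancel]
  exact (ConcreteCategory.congr_hom (HomologicalComplex.cyclesMap_i φ j) x).symm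

end TopModuleCat

/-! ### Two-cocycles from continuous cohomology -/

namespace ContinuousCohomology

open TopRep ContRepresentation

variable {k G : Type*} [Ring k] [TopologicalSpace k] [Group G] [TopologicalSpace G]
  [IsTopologicalGroup G] (X : TopRep k G)

theorem d_one_apply (H : (homogeneousCochains X).X 1) (x y z : G) :
    (((homogeneousCochains X).d 1 2).hom H).1 x y z
      = H.1 y z - (H.1 x z - H.1 x y) := by
  have h := homogeneousCochains.d_apply X 1 H
  have h' := congr($h x y z)
  exact h'

theorem d_two_apply (F : (homogeneousCochains X).X 2) (x y z w : G) :
    (((homogeneousCochains X).d 2 3).hom F).1 x y z w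
      = F.1 y z w - (F.1 x z w - (F.1 x y w - F.1 x y z)) := by
  have h := homogeneousCochains.d_apply X 2 F
  have h' := congr($h x y z w)
  exact h'

theorem apply_mul_mul (F : (homogeneousCochains X).X 1) (g x y : G) :
    F.1 (g * x) (g * y) = X.ρ g (F.1 x y) := by
  have h : X.ρ.coind₁.coind₁ g F.1 = F.1 := F.2 g
  have h' := congr($h (g * x) (g * y))
  rw [← h']
  change X.ρ g (F.1 (g⁻¹ * (g * x)) (g⁻¹ * (g * y))) = _
  simp only [inv_mul_cancel_left]

theorem apply_mul_mul_mul (F : (homogeneousCochains X).X 2) (g x y z : G) :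
    F.1 (g * x) (g * y) (g * z) = X.ρ g (F.1 x y z) := by
  have h : X.ρ.coind₁.coind₁.coind₁ g F.1 = F.1 := F.2 g
  have h' := congr($h (g * x) (g * y) (g * z))
  rw [← h']
  change X.ρ g (F.1 (g⁻¹ * (g * x)) (g⁻¹ * (g * y)) (g⁻¹ * (g * z))) = _
  simp only [inv_mul_cancel_left]

end ContinuousCohomology

namespace Goodness

open TopRep ContinuousCohomology

variable {Q : Type u} [Group Q] {M : Type u} [AddCommGroup M] [Finite M]

/-- The (inhomogeneous, not necessarily normalized) 2-cocycle identity for trivial coefficients. -/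
def IsTwoCocycle {P N : Type*} [Mul P] [Add N] (c : P → P → N) : Prop :=
  ∀ x y z, c x y + c (x * y) z = c y z + c x (y * z)

variable (Q) in
/-- The canonical homomorphism `Q → Q̂`, without reference to a topology on `Q`. -/
def toCompletionHom : Q →* Completion Q :=
  (ProfiniteGrp.ProfiniteCompletion.eta (GrpCat.of Q)).hom

theorem extendedAction_eq_one [DistribMulAction Q M] (h : ∀ (q : Q) (m : M), q • m = m) :
    extendedAction Q M = 1 := by
  have : Finite (M ≃ₗ[ℤ] M) := Finite.of_injective _ DFunLike.coe_injective
  let φ := (ProfiniteGrp.ProfiniteCompletion.lift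
    (P := ProfiniteGrp.ofFiniteGrp (FiniteGrp.of (M ≃ₗ[ℤ] M)))
    (GrpCat.ofHom (DistribMulAction.toModuleAut (S := Q) ℤ M))).hom
  have h1 : (φ : Completion Q → _) = fun _ => 1 := by
    refine (ProfiniteGrp.ProfiniteCompletion.denseRange (GrpCat.of Q)).equalizer
      φ.continuous continuous_const (funext fun q => ?_)
    refine (ConcreteCategory.congr_hom (ProfiniteGrp.ProfiniteCompletion.lift_eta
      (P := ProfiniteGrp.ofFiniteGrp (FiniteGrp.of (M ≃ₗ[ℤ] M)))
      (GrpCat.ofHom (DistribMulAction.toModuleAut (S := Q) ℤ M))) q).trans ?_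
    exact LinearEquiv.ext fun m => h q m
  exact MonoidHom.ext fun x => congrFun h1 x

variable [TopologicalSpace M] [DiscreteTopology M]

/-- The only consequence of goodness that is needed, surjectivity of `H²(Q̂, M) → H²(Q, M)` for a
trivial finite module `M`, in inhomogeneous form: every 2-cocycle on `Q` is, up to the coboundary
of some `w`, the restriction of a continuous 2-cocycle on `Q̂`. -/
theorem IsGood.exists_continuous_twoCocycle (hQ : IsGood Q) {c : Q → Q → M}
    (hc : IsTwoCocycle c) :
    ∃ f : Completion Q → Completion Q → M, Continuous (Function.uncurry f) ∧ IsTwoCocycle f ∧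
      ∃ w : Q → M, ∀ x y, f (toCompletionHom Q x) (toCompletionHom Q y) =
        c x y + w x + w y - w (x * y) := by
  let _ : TopologicalSpace Q := ⊥
  have : DiscreteTopology Q := ⟨rfl⟩
  -- `Q` acts trivially on `M`.
  let _ : DistribMulAction Q M :=
    { smul := fun _ m => m
      one_smul := fun _ => rfl
      mul_smul := fun _ _ _ => rfl
      smul_zero := fun _ => rfl
      smul_add := fun _ _ _ => rfl }
  -- The homogeneous cochain attached to `c`.
  let C : (homogeneousCochains (discreteRep.{u} (DistribMulAction.toModuleAut (S := Q) ℤ M))).X 2 :=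
    ⟨⟨fun x => ⟨fun y => ⟨fun z => c (x⁻¹ * y) (y⁻¹ * z), continuous_of_discreteTopology⟩,
      continuous_of_discreteTopology⟩, continuous_of_discreteTopology⟩, fun g => by
        refine ContinuousMap.ext fun x => ContinuousMap.ext fun y => ContinuousMap.ext fun z => ?_
        change c ((g⁻¹ * x)⁻¹ * (g⁻¹ * y)) ((g⁻¹ * y)⁻¹ * (g⁻¹ * z)) = c (x⁻¹ * y) (y⁻¹ * z)
        group⟩
  obtain ⟨F, hF, W, hW⟩ := TopModuleCat.exists_cycle_of_homologyMap_surjective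
    (cochainsMap (toCompletion Q) (restrictionHom Q M)) (i := 1) (j := 2) (k := 3) (by simp)
    (by simp) (hQ M 2).2 C (by
      refine Subtype.ext <| ContinuousMap.ext fun x => ContinuousMap.ext fun y =>
        ContinuousMap.ext fun z => ContinuousMap.ext fun t => ?_
      refine (d_two_apply _ C x y z t).trans ?_
      have h := hc (x⁻¹ * y) (y⁻¹ * z) (z⁻¹ * t)
      change c (y⁻¹ * z) (z⁻¹ * t) - (c (x⁻¹ * z) (z⁻¹ * t)
        - (c (x⁻¹ * y) (y⁻¹ * t) - c (x⁻¹ * y) (y⁻¹ * z))) = 0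
      simp only [mul_assoc, mul_inv_cancel_left] at h
      rw [← sub_eq_zero] at h
      rw [← neg_eq_zero, ← h]
      abel)
  -- `Φ` and `Ω` are `F` and `W` with values regarded in `M`.
  let Φ : Completion Q → Completion Q → Completion Q → M := fun x y z => F.1 x y z
  let Ω : Q → Q → M := fun x y => W.1 x y
  have hΦ (g x y z : Completion Q) : Φ (g * x) (g * y) (g * z) = Φ x y z :=
    (apply_mul_mul_mul _ F g x y z).trans
      (LinearEquiv.congr_fun
        (DFunLike.congr_fun (extendedAction_eq_one (M := M) fun _ _ => rfl) g) _)
  have hΩ (g x y : Q) : Ω (g * x) (g * y) = Ω x y := apply_mul_mul _ W g x y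
  have hdΦ (x y z t : Completion Q) : 0 = Φ y z t - (Φ x z t - (Φ x y t - Φ x y z)) :=
    congr(($hF).1 x y z t).symm.trans (d_two_apply _ F x y z t)
  have hdΩ (x y z : Q) : _ = Ω y z - (Ω x z - Ω x y) := d_one_apply _ W x y z
  have hΦΩ (x y z : Q) : Φ (toCompletionHom Q x) (toCompletionHom Q y) (toCompletionHom Q z) =
      c (x⁻¹ * y) (y⁻¹ * z) + (Ω y z - (Ω x z - Ω x y)) :=
    congr(($hW).1 x y z).trans
      (congrArg (fun v : M => c (x⁻¹ * y) (y⁻¹ * z) + v) (hdΩ x y z))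
  refine ⟨fun x y => Φ 1 x (x * y), ?_, fun x y z => ?_, fun x => Ω 1 x, fun x y => ?_⟩
  · -- Currying is invertible because `Q̂` is locally compact.
    let F₁ : C(Completion Q, C(Completion Q, M)) := F.1 1
    exact F₁.uncurry.continuous.comp
      (continuous_fst.prodMk (continuous_fst.mul continuous_snd))
  · have h := hdΦ 1 x (x * y) (x * (y * z))
    have h1 : Φ x (x * y) (x * (y * z)) = Φ 1 y (y * z) := by
      simpa using hΦ x 1 y (y * z)
    rw [h1] at h
    simp only [mul_assoc]
    rw [← sub_eq_zero, ← neg_eq_zero, h]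
    abel
  · have h := hΦΩ 1 x (x * y)
    have h1 : Ω x (x * y) = Ω 1 y := by simpa using hΩ x 1 y
    rw [h1, map_one, map_mul, inv_one, one_mul, inv_mul_cancel_left] at h
    simp only
    rw [h]
    abel

end Goodness

/-! ### Extensions of profinite groups by continuous cocycles -/

namespace Goodness

theorem IsTwoCocycle.one_left {P N : Type*} [Group P] [AddCommGroup N] {f : P → P → N}
    (hf : IsTwoCocycle f) (x : P) : f 1 x = f 1 1 := by
  simpa using (hf 1 1 x).symm

/-- The set `N × P`, to be equipped with the group law
`(m, x) (n, y) = (m + n + f x y, x y)` twisted by a 2-cocycle `f`. Since `f` is not assumed to be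
normalized, the neutral element is `(-f 1 1, 1)`. -/
@[ext]
structure TwistedProduct {P N : Type*} (f : P → P → N) where
  /-- The component in the kernel. -/
  fst : N
  /-- The component in the quotient. -/
  snd : P

namespace TwistedProduct

section Topology

variable {P N : Type*} {f : P → P → N} [TopologicalSpace P] [TopologicalSpace N]

/-- The underlying bijection with the product. -/
def equivProd : TwistedProduct f ≃ N × P where
  toFun a := (a.fst, a.snd)
  invFun a := ⟨a.1, a.2⟩

instance : TopologicalSpace (TwistedProduct f) := .induced equivProd inferInstance

variable (f) in
/-- The twisted product carries the product topology. -/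
def homeomorphProd : TwistedProduct f ≃ₜ N × P := equivProd.toHomeomorphOfIsInducing ⟨rfl⟩

theorem continuous_fst : Continuous (fst : TwistedProduct f → N) :=
  _root_.continuous_fst.comp (homeomorphProd f).continuous

theorem continuous_snd : Continuous (snd : TwistedProduct f → P) :=
  _root_.continuous_snd.comp (homeomorphProd f).continuous

theorem continuous_mk {T : Type*} [TopologicalSpace T] {a : T → N} {b : T → P}
    (ha : Continuous a) (hb : Continuous b) :
    Continuous fun t => (⟨a t, b t⟩ : TwistedProduct f) :=
  (homeomorphProd f).symm.continuous.comp (ha.prodMk hb)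

end Topology

variable {P N : Type*} [Group P] [AddCommGroup N] {f : P → P → N}

instance : Mul (TwistedProduct f) := ⟨fun a b => ⟨a.fst + b.fst + f a.snd b.snd, a.snd * b.snd⟩⟩
instance : One (TwistedProduct f) := ⟨⟨-f 1 1, 1⟩⟩
instance : Inv (TwistedProduct f) := ⟨fun a => ⟨-a.fst - f a.snd⁻¹ a.snd - f 1 1, a.snd⁻¹⟩⟩

@[simp] theorem mul_fst (a b : TwistedProduct f) :
    (a * b).fst = a.fst + b.fst + f a.snd b.snd := rfl
@[simp] theorem mul_snd (a b : TwistedProduct f) : (a * b).snd = a.snd * b.snd := rfl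
@[simp] theorem one_fst : (1 : TwistedProduct f).fst = -f 1 1 := rfl
@[simp] theorem one_snd : (1 : TwistedProduct f).snd = 1 := rfl
@[simp] theorem inv_fst (a : TwistedProduct f) :
    a⁻¹.fst = -a.fst - f a.snd⁻¹ a.snd - f 1 1 := rfl
@[simp] theorem inv_snd (a : TwistedProduct f) : a⁻¹.snd = a.snd⁻¹ := rfl

/-- The extension of `P` by `N` with 2-cocycle `f`. -/
abbrev group (hf : IsTwoCocycle f) : Group (TwistedProduct f) :=
  Group.ofLeftAxioms
    (fun a b c => by
      ext
      · simp only [mul_fst, mul_snd]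
        rw [← sub_eq_zero]
        have h := hf a.snd b.snd c.snd
        rw [← sub_eq_zero] at h
        rw [← h]
        abel
      · exact mul_assoc _ _ _)
    (fun a => by
      ext
      · simp [hf.one_left]
      · simp)
    (fun a => by
      ext
      · simp only [mul_fst, inv_fst, inv_snd, one_fst]
        abel
      · simp)

variable [TopologicalSpace P] [TopologicalSpace N]

theorem isTopologicalGroup [IsTopologicalGroup P] [IsTopologicalAddGroup N]
    (hf : IsTwoCocycle f) (hf' : Continuous (Function.uncurry f)) :
    letI := group hf
    IsTopologicalGroup (TwistedProduct f) :=
  letI := group hf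
  { continuous_mul := continuous_mk
      (((continuous_fst.comp _root_.continuous_fst).add
        (continuous_fst.comp _root_.continuous_snd)).add
        (hf'.comp ((continuous_snd.comp _root_.continuous_fst).prodMk
          (continuous_snd.comp _root_.continuous_snd))))
      ((continuous_snd.comp _root_.continuous_fst).mul
        (continuous_snd.comp _root_.continuous_snd))
    continuous_inv := continuous_mk
      ((continuous_fst.neg.sub (hf'.comp (continuous_snd.inv.prodMk continuous_snd))).sub
        continuous_const)
      continuous_snd.inv }

end TwistedProduct

/-- Existence in the universal property of `Ĝ`, for unbundled profinite groups. -/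
theorem exists_completion_extension {G P : Type u} [Group G] [Group P] [TopologicalSpace P]
    [IsTopologicalGroup P] [CompactSpace P] [TotallyDisconnectedSpace P] (φ : G →* P) :
    ∃ ψ : Completion G →ₜ* P, ∀ g, ψ (toCompletionHom G g) = φ g :=
  ⟨(ProfiniteGrp.ProfiniteCompletion.lift (P := ProfiniteGrp.of P) (GrpCat.ofHom φ)).hom,
    fun g => ConcreteCategory.congr_hom (ProfiniteGrp.ProfiniteCompletion.lift_eta
      (P := ProfiniteGrp.of P) (GrpCat.ofHom φ)) g⟩

theorem completionMap_toCompletionHom {G H : Type u} [Group G] [Group H] (φ : G →* H) (g : G) :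
    completionMap φ (toCompletionHom G g) = toCompletionHom H (φ g) :=
  ConcreteCategory.congr_hom (ProfiniteGrp.ProfiniteCompletion.lift_eta
    (GrpCat.ofHom φ ≫ ProfiniteGrp.ProfiniteCompletion.eta (GrpCat.of H))) g

theorem completion_funext {G : Type u} [Group G] {Y : Type*} [TopologicalSpace Y] [T2Space Y]
    {φ ψ : Completion G → Y} (hφ : Continuous φ) (hψ : Continuous ψ)
    (h : ∀ g, φ (toCompletionHom G g) = ψ (toCompletionHom G g)) : φ = ψ :=
  (ProfiniteGrp.ProfiniteCompletion.denseRange (GrpCat.of G)).equalizer hφ hψ (funext h)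

/-- If the profinite completion of a central extension of a good group `Q` splits, then every
homomorphism from the kernel `A` to a finite abelian group `M` extends to `G`.

Pushing the extension out along `p` gives a 2-cocycle on `Q` with values in `M`; by goodness it is
cohomologous to the restriction of a continuous cocycle `f` on `Q̂`, and `f` defines a profinite extension of `Q̂` by `M` that
receives a homomorphism `θ` from `G`. The extension `Θ` of `θ` to `Ĝ`, composed with the section
`Q̂ → Ĝ`, lifts `Q → Q̂` to this profinite extension, and comparing `θ` with this lift yields the
required map `G → M`. -/
theorem exists_hom_of_completionSplits {A G Q M : Type u} [Group A] [Group G] [Group Q]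
    [AddCommGroup M] [Finite M] (S : GroupExtension A G Q)
    (hcentral : S.inl.range ≤ Subgroup.center G) (hQ : IsGood Q) (hsplit : CompletionSplits S)
    (p : A →* Multiplicative M) :
    ∃ r : G →* Multiplicative M, ∀ a, r (S.inl a) = p a := by
  obtain ⟨s, hs⟩ := hsplit
  let _ : TopologicalSpace M := ⊥
  have : DiscreteTopology M := ⟨rfl⟩
  -- `t` is a set-theoretic section, `a` the corresponding coordinate along `A`, and `m` its image
  -- in `M`; the cocycle of the pushed-out extension is then `m (t x * t y)`.
  obtain ⟨t, ht⟩ := S.rightHom_surjective.hasRightInverse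
  have ha (g : G) : ∃ a : A, S.inl a * t (S.rightHom g) = g := by
    have : g * (t (S.rightHom g))⁻¹ ∈ S.inl.range := by
      rw [S.range_inl_eq_ker_rightHom, MonoidHom.mem_ker, map_mul, map_inv, ht, mul_inv_cancel]
    obtain ⟨a, ha⟩ := this
    exact ⟨a, by rw [ha, inv_mul_cancel_right]⟩
  choose a ha using ha
  have hcomm (b : A) (g : G) : g * S.inl b = S.inl b * g :=
    Subgroup.mem_center_iff.1 (hcentral ⟨b, rfl⟩) g
  have ha_inl (b : A) (g : G) : a (S.inl b * g) = b * a g := by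
    apply S.inl_injective
    have h := ha (S.inl b * g)
    rw [map_mul, S.rightHom_inl, one_mul] at h
    rw [map_mul, ← mul_left_inj (t (S.rightHom g)), h, mul_assoc, ha]
  let m (g : G) : M := (p (a g)).toAdd
  have hm_inl (b : A) (g : G) : m (S.inl b * g) = (p b).toAdd + m g := by
    simp only [m, ha_inl, map_mul, toAdd_mul]
  have hm_mul (g h : G) :
      m (g * h) = m g + m h + m (t (S.rightHom g) * t (S.rightHom h)) := by
    have : g * h = S.inl (a g * a h) * (t (S.rightHom g) * t (S.rightHom h)) := by
      conv_lhs => rw [← ha g, ← ha h]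
      rw [map_mul]
      simp only [mul_assoc]
      rw [← mul_assoc (t _) (S.inl _), hcomm, mul_assoc]
    conv_lhs => rw [this]
    rw [hm_inl]
    simp only [m, map_mul, toAdd_mul]
  have hc : IsTwoCocycle fun x y => m (t x * t y) := fun x y z => by
    have h1 := hm_mul (t x * t y) (t z)
    have h2 := hm_mul (t x) (t y * t z)
    simp only [map_mul, ht _] at h1 h2
    rw [mul_assoc, h2] at h1
    have h0 (x : Q) : m (t x) = 0 := by
      have h := ha (t x)
      rw [ht x, mul_eq_right, map_eq_one_iff _ S.inl_injective] at h
      simp [m, h]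
    simp only [h0] at h1
    simpa [add_comm] using h1.symm
  obtain ⟨f, hf, hfc, w, hw⟩ := hQ.exists_continuous_twoCocycle hc
  let _ := TwistedProduct.group hfc
  have := TwistedProduct.isTopologicalGroup hfc hf
  have : CompactSpace (TwistedProduct f) := (TwistedProduct.homeomorphProd f).symm.compactSpace
  have : TotallyDisconnectedSpace (TwistedProduct f) :=
    (TwistedProduct.homeomorphProd f).isEmbedding.isTotallyDisconnected_range.1
      (isTotallyDisconnected_of_totallyDisconnectedSpace _)
  let θ : G →* TwistedProduct f := MonoidHom.mk'
    (fun g => ⟨m g - w (S.rightHom g), toCompletionHom Q (S.rightHom g)⟩) fun g h => by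
      ext
      · simp only [TwistedProduct.mul_fst, hw, hm_mul g h, map_mul]
        abel
      · simp
  obtain ⟨Θ, hΘ⟩ := exists_completion_extension θ
  have hΘ' : ∀ x, (Θ x).snd = completionMap S.rightHom x :=
    congrFun <| completion_funext (TwistedProduct.continuous_snd.comp Θ.continuous)
      (completionMap S.rightHom).continuous fun g => by
        rw [completionMap_toCompletionHom, hΘ]; rfl
  -- The lift of `Q → Q̂` to the twisted product that the section `s` provides.
  let κ (q : Q) : TwistedProduct f := Θ (s (toCompletionHom Q q))
  have hκ (q : Q) : (κ q).snd = toCompletionHom Q q := by rw [hΘ', hs]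
  have hκ_mul (x y : Q) : κ (x * y) = κ x * κ y := by simp only [κ, map_mul]
  -- `θ g` and `κ (π g)` have the same component in `Q̂`, so the cocycle terms cancel in the
  -- difference of their components in `M`.
  let r : G →* Multiplicative M := MonoidHom.mk'
    (fun g => .ofAdd ((θ g).fst - (κ (S.rightHom g)).fst)) fun g h => by
      rw [← ofAdd_add, map_mul, map_mul, hκ_mul]
      simp only [TwistedProduct.mul_fst, hκ]
      change Multiplicative.ofAdd (_ + _ + f (toCompletionHom Q _) (toCompletionHom Q _) - _) = _
      congr 1
      abel
  -- The section `t` need not preserve `1`, so `a (inl b)` may differ from `b`; equivariance under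
  -- `A` avoids this.
  refine ⟨r, fun b => ?_⟩
  have h (g : G) : r (S.inl b * g) = p b * r g := by
    apply Multiplicative.toAdd.injective
    change m (S.inl b * g) - w (S.rightHom (S.inl b * g)) - (κ (S.rightHom (S.inl b * g))).fst =
      (p b).toAdd + (m g - w (S.rightHom g) - (κ (S.rightHom g)).fst)
    rw [map_mul, S.rightHom_inl, one_mul, hm_inl]
    abel
  simpa using h 1

end Goodness

/-! ### Finitely generated abelian groups -/

/-- Since a finitely generated abelian group is a direct sum of cyclic groups, a homomorphism onto
it has a section as soon as every element annihilated by `n` lifts to one annihilated by `n`. For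
`n = 0` the hypothesis is surjectivity. -/
theorem AddMonoidHom.exists_section_of_torsion_lifts {B C : Type*} [AddCommGroup B]
    [AddCommGroup C] [AddGroup.FG C] (π : B →+ C)
    (h : ∀ (n : ℕ) (c : C), n • c = 0 → ∃ b, π b = c ∧ n • b = 0) :
    ∃ s : C →+ B, ∀ c, π (s c) = c := by
  classical
  obtain ⟨n, ι, _, p, -, k, ⟨e⟩⟩ := AddCommGroup.equiv_free_prod_directSum_zmod C
  choose b hb _ using fun i : Fin n => h 0 (e.symm (Finsupp.single i 1, 0)) (zero_nsmul _)
  choose b' hb' hb0 using fun i : ι =>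
    h (p i ^ k i) (e.symm (0, DirectSum.of (fun i => ZMod (p i ^ k i)) i 1)) (by
      rw [← map_nsmul, Prod.smul_mk, ← map_nsmul, nsmul_one, ZMod.natCast_self]; simp)
  let s₁ : (Fin n →₀ ℤ) →+ B := Finsupp.liftAddHom fun i => zmultiplesHom B (b i)
  let s₂ : (DirectSum ι fun i => ZMod (p i ^ k i)) →+ B := DirectSum.toAddMonoid fun i =>
    ZMod.lift _ ⟨zmultiplesHom B (b' i), by
      rw [zmultiplesHom_apply, natCast_zsmul, hb0]⟩
  have hs₁ : π.comp s₁ = e.symm.toAddMonoidHom.comp (AddMonoidHom.inl _ _) := by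
    ext i
    simp [s₁, hb]
  have hs₂ : π.comp s₂ = e.symm.toAddMonoidHom.comp (AddMonoidHom.inr _ _) := by
    refine DirectSum.addHom_ext' fun i => ?_
    have h1 : s₂ (DirectSum.of (fun i => ZMod (p i ^ k i)) i 1) = b' i := by
      have := ZMod.lift_coe (p i ^ k i) ⟨zmultiplesHom B (b' i), by
        rw [zmultiplesHom_apply, natCast_zsmul, hb0]⟩ 1
      simpa [s₂] using this
    ext x
    obtain ⟨j, rfl⟩ := ZMod.intCast_surjective x
    rw [← zsmul_one, map_zsmul, map_zsmul]
    simp [h1, hb']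
  refine ⟨(s₁.coprod s₂).comp e.toAddMonoidHom, fun c => ?_⟩
  have h1 := DFunLike.congr_fun hs₁ (e c).1
  have h2 := DFunLike.congr_fun hs₂ (e c).2
  simp only [AddMonoidHom.comp_apply, AddMonoidHom.inl_apply, AddMonoidHom.inr_apply] at h1 h2
  simp only [AddMonoidHom.comp_apply, AddMonoidHom.coprod_apply, map_add,
    AddEquiv.coe_toAddMonoidHom] at h1 h2 ⊢
  rw [h1, h2, ← map_add, Prod.mk_add_mk, add_zero, zero_add, e.symm_apply_apply]

/-- A pure subgroup of a finitely generated abelian group is a direct summand. -/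
theorem AddMonoidHom.exists_retraction_of_pure {A B : Type*} [AddCommGroup A] [AddCommGroup B]
    [AddGroup.FG B] (i : A →+ B) (hi : Function.Injective i)
    (hpure : ∀ (n : ℕ) (b : B) (a : A), n • b = i a → ∃ a', n • a' = a) :
    ∃ ρ : B →+ A, ∀ a, ρ (i a) = a := by
  have : AddGroup.FG (B ⧸ i.range) := QuotientAddGroup.fg _
  obtain ⟨s, hs⟩ := (QuotientAddGroup.mk' i.range).exists_section_of_torsion_lifts
    fun n c hc => by
      obtain ⟨b, rfl⟩ := QuotientAddGroup.mk'_surjective _ c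
      rw [← map_nsmul] at hc
      obtain ⟨a, ha⟩ := (QuotientAddGroup.eq_zero_iff _).1 hc
      obtain ⟨a', rfl⟩ := hpure n b a ha.symm
      refine ⟨b - i a', ?_, by rw [smul_sub, ← ha, map_nsmul, sub_self]⟩
      rw [map_sub, sub_eq_self]
      exact (QuotientAddGroup.eq_zero_iff _).2 ⟨a', rfl⟩
  have hρ (b : B) : ∃ a, i a = b - s b := by
    refine (QuotientAddGroup.eq_zero_iff (N := i.range) (b - s b)).1 ?_
    exact (map_sub (QuotientAddGroup.mk' i.range) _ _).trans (sub_eq_zero.2 (hs _).symm)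
  choose ρ hρ using hρ
  refine ⟨AddMonoidHom.mk' ρ fun x y => hi ?_, fun a => hi ?_⟩
  · rw [map_add, hρ, hρ, hρ, QuotientAddGroup.mk_add, map_add]
    abel
  · have : ((i a : B) : B ⧸ i.range) = 0 := (QuotientAddGroup.eq_zero_iff _).2 ⟨a, rfl⟩
    simp [hρ, this]

/-- A finitely generated abelian group has no nonzero element that is divisible by every positive
integer. -/
theorem AddCommGroup.eq_zero_of_forall_exists_nsmul_eq {A : Type*} [AddCommGroup A]
    [AddGroup.FG A] {a : A} (h : ∀ n : ℕ, 0 < n → ∃ x, n • x = a) : a = 0 := by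
  classical
  obtain ⟨n, ι, _, p, hp, k, ⟨e⟩⟩ := AddCommGroup.equiv_free_prod_directSum_zmod A
  rw [← map_eq_zero_iff e e.injective]
  refine Prod.ext (Finsupp.ext fun i => ?_) (DFinsupp.ext fun i => ?_)
  · -- An integer `z` divisible by `|z| + 1` vanishes.
    obtain ⟨x, hx⟩ := h (((e a).1 i).natAbs + 1) (Nat.succ_pos _)
    have h1 : (((e a).1 i).natAbs + 1) • (e x).1 i = (e a).1 i := by
      conv_rhs => rw [← hx, map_nsmul]
      rfl
    refine Int.eq_zero_of_abs_lt_dvd (m := (((e a).1 i).natAbs + 1 : ℕ)) ⟨(e x).1 i, ?_⟩ ?_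
    · rw [← nsmul_eq_mul, h1]
    · rw [Nat.cast_add, Nat.cast_one, Int.natCast_natAbs]
      exact lt_add_one _
  · obtain ⟨x, rfl⟩ := h (p i ^ k i) (pow_pos (hp i).pos _)
    rw [map_nsmul]
    change p i ^ k i • (e x).2 i = 0
    rw [nsmul_eq_mul, ZMod.natCast_self, zero_mul]

theorem AddCommGroup.finite_quotient_nsmul {A : Type*} [AddCommGroup A] [AddGroup.FG A] {n : ℕ}
    (hn : 0 < n) : Finite (A ⧸ (nsmulAddMonoidHom (α := A) n).range) := by
  have : AddGroup.FG (A ⧸ (nsmulAddMonoidHom (α := A) n).range) := QuotientAddGroup.fg _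
  apply AddCommGroup.finite_of_fg_isAddTorsion
  intro x
  obtain ⟨a, rfl⟩ := QuotientAddGroup.mk'_surjective _ x
  refine isOfFinAddOrder_iff_nsmul_eq_zero.2 ⟨n, hn, ?_⟩
  rw [← map_nsmul]
  exact (QuotientAddGroup.eq_zero_iff _).2 ⟨a, rfl⟩

/-! ### Splittings of central extensions -/

/-- A retraction of `G` onto a central kernel yields the splitting `π g ↦ g * (r g)⁻¹`. -/
theorem GroupExtension.nonempty_splitting_of_retraction {A G Q : Type*} [Group A] [Group G]
    [Group Q] (S : GroupExtension A G Q) (hcentral : S.inl.range ≤ Subgroup.center G)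
    (r : G →* A) (hr : ∀ a, r (S.inl a) = a) : Nonempty S.Splitting := by
  have hcomm (b : A) (g : G) : g * S.inl b = S.inl b * g :=
    Subgroup.mem_center_iff.1 (hcentral ⟨b, rfl⟩) g
  let ψ : G →* G := MonoidHom.mk' (fun g => g * S.inl (r g)⁻¹) fun g h => by
    have : r (g * h) = r h * r g := S.inl_injective (by
      rw [map_mul, map_mul, map_mul, hcomm])
    rw [this, mul_inv_rev, map_mul]
    simp only [mul_assoc]
    congr 1
    rw [← mul_assoc, hcomm (r g)⁻¹ h, mul_assoc]
  have hψ : S.rightHom.ker ≤ ψ.ker := by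
    rw [← S.range_inl_eq_ker_rightHom]
    rintro _ ⟨a, rfl⟩
    rw [MonoidHom.mem_ker]
    change S.inl a * S.inl (r (S.inl a))⁻¹ = 1
    rw [hr, ← map_mul, mul_inv_cancel, map_one]
  let σ : Q →* G := S.rightHom.liftOfSurjective S.rightHom_surjective ⟨ψ, hψ⟩
  refine ⟨⟨σ, fun q => ?_⟩⟩
  obtain ⟨g, rfl⟩ := S.rightHom_surjective q
  have : σ (S.rightHom g) = ψ g :=
    S.rightHom.liftOfRightInverse_comp_apply _ _ ⟨ψ, hψ⟩ g
  change S.rightHom (σ _) = _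
  rw [this]
  change S.rightHom (g * S.inl (r g)⁻¹) = _
  rw [map_mul, S.rightHom_inl, mul_one]

theorem GroupExtension.fg {A G Q : Type*} [Group A] [Group G] [Group Q]
    (S : GroupExtension A G Q) [Group.FG A] [Group.FG Q] : Group.FG G := by
  obtain ⟨T, hT, hTfin⟩ := Group.fg_iff.1 (inferInstance : Group.FG Q)
  obtain ⟨t, ht⟩ := S.rightHom_surjective.hasRightInverse
  let H : Subgroup G := S.inl.range ⊔ Subgroup.closure (t '' T)
  have hH : H.FG := .sup ((Group.fg_iff_subgroup_fg _).1 inferInstance)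
    ((Subgroup.fg_iff _).2 ⟨_, rfl, hTfin.image t⟩)
  suffices H = ⊤ from Group.fg_def.2 (this ▸ hH)
  have hmap : H.map S.rightHom = ⊤ := by
    rw [eq_top_iff, ← hT, Subgroup.closure_le]
    exact fun q hq => ⟨t q, Subgroup.mem_sup_right (Subgroup.subset_closure ⟨q, hq, rfl⟩), ht q⟩
  have hker : S.rightHom.ker ≤ H := S.range_inl_eq_ker_rightHom ▸ le_sup_left
  rw [← Subgroup.comap_map_eq_self hker, hmap, Subgroup.comap_top]

/-- If every quotient map `A → A / nA`, `n > 0`, extends to `G`, then `A` is a retract of `G`. The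
extensions factor through the abelianization of `G`; they show that `A` embeds there as a pure
subgroup, hence as a direct summand. -/
theorem MonoidHom.exists_retraction_of_forall_quotient {A G : Type*} [CommGroup A] [Group G]
    [Group.FG A] [Group.FG G] (i : A →* G)
    (h : ∀ n : ℕ, 0 < n → ∃ r : G →*
      Multiplicative (Additive A ⧸ (nsmulAddMonoidHom (α := Additive A) n).range),
      ∀ a, r (i a) = .ofAdd (QuotientAddGroup.mk (Additive.ofMul a))) :
    ∃ r : G →* A, ∀ a, r (i a) = a := by
  let ι : Additive A →+ Additive (Abelianization G) := (Abelianization.of.comp i).toAdditive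
  -- An element of `A` that is divisible by `n` in the abelianization of `G` is so in `A`.
  have hdiv (n : ℕ) (hn : 0 < n) (b : Additive (Abelianization G)) (a : Additive A)
      (hb : n • b = ι a) : ∃ a', n • a' = a := by
    obtain ⟨r, hr⟩ := h n hn
    let r' := Abelianization.lift r
    have h1 : r' (ι a).toMul = .ofAdd (QuotientAddGroup.mk a) := by
      change Abelianization.lift r (Abelianization.of (i a.toMul)) = _
      rw [Abelianization.lift_apply_of, hr]
      rfl
    rw [← hb, toMul_nsmul, map_pow] at h1
    obtain ⟨c, hc⟩ := QuotientAddGroup.mk_surjective (r' b.toMul).toAdd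
    have h2 : (QuotientAddGroup.mk a : Additive A ⧸ (nsmulAddMonoidHom (α := Additive A) n).range)
        = 0 := by
      rw [← toAdd_ofAdd (QuotientAddGroup.mk a), ← h1, toAdd_pow, ← hc]
      exact (QuotientAddGroup.eq_zero_iff _).2 ⟨c, rfl⟩
    exact (QuotientAddGroup.eq_zero_iff _).1 h2
  have : AddGroup.FG (Additive A) := inferInstance
  have : Group.FG (Abelianization G) := QuotientGroup.fg _
  have hι : Function.Injective ι := (injective_iff_map_eq_zero ι).2 fun a ha =>
    AddCommGroup.eq_zero_of_forall_exists_nsmul_eq fun n hn =>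
      hdiv n hn 0 a (by rw [smul_zero, ha])
  obtain ⟨ρ, hρ⟩ := ι.exists_retraction_of_pure hι fun n b a hb => by
    rcases n.eq_zero_or_pos with rfl | hn
    · exact ⟨0, (hι (by rw [← hb, zero_smul, zero_smul, map_zero])).symm⟩
    · exact hdiv n hn b a hb
  exact ⟨(AddMonoidHom.toMultiplicative ρ : Abelianization G →* A).comp Abelianization.of,
    fun a => hρ (.ofMul a)⟩

theorem mainTheorem5 {A G Q : Type u} [Group A] [Group G] [Group Q]
    (S : GroupExtension A G Q) (hcentral : S.inl.range ≤ Subgroup.center G)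
    (hA : Group.FG A) (hQ : Group.FG Q) (hgood : Goodness.IsGood Q)
    (hsplit : Goodness.CompletionSplits S) :
    Nonempty S.Splitting := by
  let _ : CommGroup A :=
    { ‹Group A› with
      mul_comm := fun a b => S.inl_injective (by
        rw [map_mul, map_mul]
        exact Subgroup.mem_center_iff.1 (hcentral ⟨b, rfl⟩) _) }
  have : Group.FG G := S.fg
  obtain ⟨r, hr⟩ := MonoidHom.exists_retraction_of_forall_quotient S.inl fun n hn => by
    have := AddCommGroup.finite_quotient_nsmul (A := Additive A) hn
    exact Goodness.exists_hom_of_completionSplits S hcentral hgood hsplit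
      (AddMonoidHom.toMultiplicative
        (QuotientAddGroup.mk' (nsmulAddMonoidHom (α := Additive A) n).range))
  exact S.nonempty_splitting_of_retraction hcentral r hr
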